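/- **Setting.** Let $H$ be an infinite-dimensional separable real Hilbert space and $L$ a positive self-adjoint operator on $H$ with an orthonormal basis of eigenvectors $(\varphi_i)_{i\in\mathbb N}$ and eigenvalues $\lambda_i$, with $\lambda_{\min}:=\inf_i\lambda_i>0$. For $s\in\mathbb R$ let $V^s$ be the space with norm $\|v\|_{V^s}^2=\sum_i\lambda_i^s\langle v,\varphi_i\rangle^2$; so $V^0=H$, $V:=V^1=D(L^{1/2})$, $V'=V^{-1}$. For $k\ge1$ and $\alpha,q\in\mathbb R$ let $V^\alpha_q(k)$ be the $k$-fold tensor space with norm $$\|v\|^2_{V^\alpha_q(k)}=\sum_{i\in\mathbb N^k}\Big(\prod_{l}\lambda_{i_l}\Big)^{\alpha}\Big(\sum_{l}\lambda_{i_l}\Big)^{q}\langle v,\varphi_{i_1}\otimes\cdots\otimes\varphi_{i_k}\rangle^2 ,$$ $H(k)=V^0_0(k)$, $U^0_q(N)=\bigoplus_{k=1}^NV^0_q(k)$ and $Y(N)=\bigoplus_{k=1}^NH(k)$ (Hilbert sums); $U^0_{-1}(N)$ is the dual of $U^0_1(N)$, with pairing $\langle\cdot,\cdot\rangle_{U_1^0(N)}$.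 **Assumptions.** Let $A:V\to V'$ be linear with $$|\langle Av,w\rangle_V|\le\beta\|v\|_V\|w\|_V\quad\text{(A1)},\qquad \langle Av,v\rangle_V+\lambda\|v\|_H^2\ge\gamma\|v\|_V^2\quad\text{(A2)}$$ for all $v,w\in V$, where $\gamma>0$ and $\lambda\ge0$. Put $A_\lambda=A+\lambda I$; for $s>0$ its power $A_\lambda^{-s}$ is $$A_\lambda^{-s}=\frac{\Gamma(m)}{\Gamma(s)\Gamma(m-s)}\int_0^\infty t^{m-s-1}(t+A_\lambda)^{-m}\,dt\in\mathcal L(V')\qquad(m\in\mathbb N,\ m>s),$$ $A_\lambda^{0}=I$, $A_\lambda^{s}=(A_\lambda^{-s})^{-1}$, and $D(A_\lambda^s)=A_\lambda^{-s}H$. Assume $D(L^{\bar\alpha/2})=D(A_\lambda^{\bar\alpha/2})$ for some $\bar\alpha\ge1$ and let $\alpha\in[0,\bar\alpha-1]$. Let $B:V^\alpha_1(2)\to V^{\alpha-1}$ be linear with, for some $c_B>0$, $$\|Bv\|_{V^{\alpha-1}}\le c_B\|v\|_{V^\alpha_1(2)}\quad\text{for all }v\in V^\alpha_1(2)\qquad\text{((A4)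 with }\varepsilon=0),$$ and let $f\in L^\infty(0,T;V^\alpha)$ with $T\in(0,\infty]$. **Transformed operator.** Put $\widetilde B=A_\lambda^{\alpha/2}B(A_\lambda^{-\alpha/2}\otimes A_\lambda^{-\alpha/2})$ and $\tilde f(t)=A_\lambda^{\alpha/2}f(t)$. For an operator (or vector) $S$ the Kronecker sum is $\bigoplus^kS=\sum_{l=1}^k I^{\otimes(l-1)}\otimes S\otimes I^{\otimes(k-l)}$; let $A_k=\bigoplus^kA$, $\widetilde B_k=\bigoplus^k\widetilde B$ and $\widetilde F_k(t)=\bigoplus^k(-\tilde f(t))$. Let $\widetilde{\mathcal A}_N(t)$ be the block tridiagonal $N\times N$ operator with diagonal blocks $A_1,\dots,A_N$, upper diagonal blocks $\widetilde B_1,\dots,\widetilde B_{N-1}$ and lower diagonal blocks $\widetilde F_2(t),\dots,\widetilde F_N(t)$. **Constants.** Let $$c_{\mathcal B}(\alpha,0)=\sqrt2\,\|A_\lambda^{\alpha/2}\|_{\mathcal L(V^{\alpha-1},V^{-1})}\,\|A_\lambda^{-\alpha/2}\otimes A_\lambda^{-\alpha/2}\|_{\mathcal L(V^0_1(2),V^\alpha_1(2))}\,c_B,\qquad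 c_{\mathcal F}(\alpha,0)=\frac{\sqrt2}{\lambda_{\min}}\,\|A_\lambda^{\alpha/2}L^{-\alpha/2}\|_{\mathcal L(H,H)},$$ where a norm is understood as $+\infty$ if there is no such bounded operator, and $$c_{\mathcal P}:=c_{\mathcal B}(\alpha,0)+c_{\mathcal F}(\alpha,0)\,\|f\|_{L^\infty(0,T;V^\alpha)} .$$ **Proposition.** If $c_{\mathcal P}<\gamma$, then for almost every $t\in(0,T)$ and for every $N\in\mathbb N$, $\widetilde{\mathcal A}_N(t)$ is a well-defined bounded linear operator $U^0_1(N)\to U^0_{-1}(N)$, and for all $u,v\in U_1^0(N)$ $$|\langle\widetilde{\mathcal A}_N(t)u,v\rangle_{U_1^0(N)}|\le(\beta+c_{\mathcal P})\|u\|_{U_1^0(N)}\|v\|_{U_1^0(N)},$$ $$\langle\widetilde{\mathcal A}_N(t)v,v\rangle_{U_1^0(N)}+N\lambda\|v\|^2_{Y(N)}\ge(\gamma-c_{\mathcal P})\|v\|^2_{U_1^0(N)} .$$ -/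

import Mathlib

open MeasureTheory
open scoped ENNReal NNReal

noncomputable section

namespace Carleman

/-! ### Weighted `ℓ²` spaces -/

/-- Positive weights on an index set. -/
abbrev Weight (ι : Type) : Type := ι → {r : ℝ // 0 < r}

theorem summable_weight_add {ι : Type} (w : Weight ι) {x y : ι → ℝ}
    (hx : Summable fun i => (w i : ℝ) * x i ^ 2) (hy : Summable fun i => (w i : ℝ) * y i ^ 2) :
    Summable fun i => (w i : ℝ) * (x i + y i) ^ 2 := by
  refine Summable.of_nonneg_of_le (fun i => mul_nonneg (w i).2.le (sq_nonneg _)) (fun i => ?_)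
    ((hx.add hy).mul_left 2)
  have h := (w i).2
  have h2 := mul_nonneg h.le (sq_nonneg (x i - y i))
  nlinarith

/-- The families `x` with `∑ i, w i * (x i) ^ 2 < ∞`, as a linear space. -/
def wsub {ι : Type} (w : Weight ι) : Submodule ℝ (ι → ℝ) where
  carrier := {x | Summable fun i => (w i : ℝ) * x i ^ 2}
  add_mem' := fun hx hy => summable_weight_add w hx hy
  zero_mem' := by simp [summable_zero]
  smul_mem' := fun c x hx => by
    refine ((hx : Summable _).mul_left (c ^ 2)).congr (fun i => ?_)
    simp only [Pi.smul_apply, smul_eq_mul]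
    ring

/-- The weighted space `ℓ²(w)`, a Hilbert space with `‖x‖² = ∑ i, w i * (x i) ^ 2`
(see `WL.norm_sq`). -/
def WL {ι : Type} (w : Weight ι) : Type := wsub w

namespace WL

variable {ι κ : Type} {w : Weight ι}

instance : AddCommGroup (WL w) := inferInstanceAs (AddCommGroup (wsub w))

instance : Module ℝ (WL w) := inferInstanceAs (Module ℝ (wsub w))

instance : CoeFun (WL w) (fun _ => ι → ℝ) := ⟨fun x => x.1⟩

theorem summable (x : WL w) : Summable fun i => (w i : ℝ) * x i ^ 2 := x.2

@[ext] theorem ext {x y : WL w} (h : ∀ i, x i = y i) : x = y := Subtype.ext (funext h)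

@[simp] theorem zero_apply (i : ι) : (0 : WL w) i = 0 := rfl

@[simp] theorem add_apply (x y : WL w) (i : ι) : (x + y) i = x i + y i := rfl

@[simp] theorem smul_apply (c : ℝ) (x : WL w) (i : ι) : (c • x) i = c * x i := rfl

/-- Multiplication by `√w` identifies `ℓ²(w)` with `ℓ²`. -/
def equivLp (w : Weight ι) : WL w ≃ₗ[ℝ] lp (fun _ : ι => ℝ) 2 where
  toFun x := ⟨fun i => Real.sqrt (w i) * x i, by
    refine memℓp_gen ?_
    refine x.summable.congr (fun i => ?_)
    simp [mul_pow, Real.sq_sqrt (w i).2.le]⟩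
  invFun y := ⟨fun i => (Real.sqrt (w i))⁻¹ * y i, by
    have h := (memℓp_gen_iff (by simp)).1 y.2
    refine h.congr (fun i => ?_)
    have hs : Real.sqrt (w i : ℝ) ^ 2 = w i := Real.sq_sqrt (w i).2.le
    have h0 : (w i : ℝ) ≠ 0 := (w i).2.ne'
    simp [mul_pow, hs, h0]⟩
  map_add' x y := by
    ext i
    exact mul_add _ _ _
  map_smul' c x := by
    ext i
    simp only [smul_apply, RingHom.id_apply, lp.coeFn_smul, Pi.smul_apply, smul_eq_mul]
    ring
  left_inv x := by
    ext i
    have h0 : Real.sqrt (w i : ℝ) ≠ 0 := (Real.sqrt_pos.2 (w i).2).ne'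
    change (Real.sqrt (w i : ℝ))⁻¹ * (Real.sqrt (w i : ℝ) * x i) = x i
    field_simp
  right_inv y := by
    ext i
    have h0 : Real.sqrt (w i : ℝ) ≠ 0 := (Real.sqrt_pos.2 (w i).2).ne'
    change Real.sqrt (w i : ℝ) * ((Real.sqrt (w i : ℝ))⁻¹ * y i) = y i
    field_simp

instance : NormedAddCommGroup (WL w) :=
  NormedAddCommGroup.induced (WL w) (lp (fun _ : ι => ℝ) 2) (equivLp w).toLinearMap
    (equivLp w).injective

instance : NormedSpace ℝ (WL w) :=
  NormedSpace.induced ℝ (WL w) (lp (fun _ : ι => ℝ) 2) (equivLp w).toLinearMap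

theorem norm_sq (x : WL w) : ‖x‖ ^ 2 = ∑' i, (w i : ℝ) * x i ^ 2 := by
  have h : ‖x‖ = ‖equivLp w x‖ := rfl
  have h2 := lp.norm_rpow_eq_tsum (p := 2) (by simp) (equivLp w x)
  rw [h]
  simp only [ENNReal.toReal_ofNat, Real.rpow_ofNat] at h2
  rw [h2]
  refine tsum_congr (fun i => ?_)
  change ‖Real.sqrt (w i : ℝ) * x i‖ ^ 2 = _
  simp [mul_pow, Real.sq_sqrt (w i).2.le]

/-- `equivLp` as an isometry. -/
def isometryLp (w : Weight ι) : WL w ≃ₗᵢ[ℝ] lp (fun _ : ι => ℝ) 2 where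
  toLinearEquiv := equivLp w
  norm_map' _ := rfl

instance : CompleteSpace (WL w) :=
  (isometryLp w).toIsometryEquiv.completeSpace

/-- Restriction of families along an injective map `g` of index sets, where the weight of the
target is dominated by the one of the source. For `g = id` it is an embedding. -/
def pull {w' : Weight κ} (g : κ → ι) (hg : Function.Injective g)
    (hw : ∃ C : ℝ, ∀ a, (w' a : ℝ) ≤ C * w (g a)) : WL w →L[ℝ] WL w' :=
  have hC : ∃ C : ℝ, 0 ≤ C ∧ ∀ a, (w' a : ℝ) ≤ C * w (g a) := by
    obtain ⟨C, hC⟩ := hw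
    exact ⟨|C|, abs_nonneg C, fun a => (hC a).trans
      (mul_le_mul_of_nonneg_right (le_abs_self C) (w (g a)).2.le)⟩
  have hle : ∀ C : ℝ, (∀ a, (w' a : ℝ) ≤ C * w (g a)) → ∀ (x : WL w) (a : κ),
      (w' a : ℝ) * x (g a) ^ 2 ≤ C * ((w (g a) : ℝ) * x (g a) ^ 2) := fun C hC x a => by
    have := mul_le_mul_of_nonneg_right (hC a) (sq_nonneg (x (g a)))
    linarith
  have hs : ∀ x : WL w, Summable fun a => (w' a : ℝ) * x (g a) ^ 2 := fun x => by
    obtain ⟨C, -, hC⟩ := hC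
    exact Summable.of_nonneg_of_le (fun a => mul_nonneg (w' a).2.le (sq_nonneg _))
      (hle C hC x) ((x.summable.comp_injective hg).mul_left C)
  LinearMap.mkContinuousOfExistsBound
    { toFun := fun x => (⟨fun a => x (g a), hs x⟩ : WL w')
      map_add' := fun _ _ => rfl
      map_smul' := fun _ _ => rfl } (by
    obtain ⟨C, hC0, hC⟩ := hC
    refine ⟨Real.sqrt C, fun x => ?_⟩
    refine abs_le_of_sq_le_sq' ?_ (by positivity) |>.2
    rw [mul_pow, Real.sq_sqrt hC0, norm_sq, norm_sq]
    calc ∑' a, (w' a : ℝ) * x (g a) ^ 2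
        ≤ ∑' a, C * ((w (g a) : ℝ) * x (g a) ^ 2) :=
          (hs x).tsum_le_tsum (hle C hC x) ((x.summable.comp_injective hg).mul_left C)
      _ = C * ∑' a, (w (g a) : ℝ) * x (g a) ^ 2 := tsum_mul_left
      _ ≤ C * ∑' i, (w i : ℝ) * x i ^ 2 := by
          refine mul_le_mul_of_nonneg_left ?_ hC0
          exact tsum_comp_le_tsum_of_inj x.summable
            (fun i => mul_nonneg (w i).2.le (sq_nonneg _)) hg)

@[simp] theorem pull_apply {w' : Weight κ} (g : κ → ι) (hg : Function.Injective g)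
    (hw : ∃ C : ℝ, ∀ a, (w' a : ℝ) ≤ C * w (g a)) (x : WL w) (a : κ) :
    pull (w' := w') g hg hw x a = x (g a) := rfl

/-- The duality pairing `∑ i, x i * y i` (of `ℓ²(1/w)` with `ℓ²(w)`). -/
def pair {w' : Weight ι} (x : WL w') (y : WL w) : ℝ := ∑' i, x i * y i

end WL

/-! ### The scale of spaces generated by `L` -/

/-- The eigenvalues `λ_i` of the positive self-adjoint operator `L`, with respect to an orthonormal
eigenbasis `φ_i`, `i ∈ ℕ`, of the Hilbert space `H`; they are bounded below by a positive number.
Every element `v` of the spaces below is represented by its coefficients `⟨v, φ_i⟩`, and every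
element of the tensor spaces by its coefficients `⟨v, φ_{i₁} ⊗ ⋯ ⊗ φ_{iₖ}⟩`. -/
structure EigenSystem where
  /-- the `i`-th eigenvalue -/
  ev : ℕ → ℝ
  bddBelow : ∃ c : ℝ, 0 < c ∧ ∀ i, c ≤ ev i

namespace EigenSystem

variable (E : EigenSystem)

theorem ev_pos (i : ℕ) : 0 < E.ev i := by
  obtain ⟨c, hc, h⟩ := E.bddBelow
  exact hc.trans_le (h i)

/-- The bottom of the spectrum of `L`. -/
def evMin : ℝ := ⨅ i, E.ev i

/-- The weight `λ_i ^ s`. -/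
def wt (s : ℝ) : Weight ℕ := fun i => ⟨E.ev i ^ s, Real.rpow_pos_of_pos (E.ev_pos i) s⟩

/-- The space `V^s`, with `‖v‖² = ∑ i, λ_i ^ s * ⟨v, φ_i⟩²`. So `V^0 = H`, `V^1 = V`, and `V^{-s}`
is the dual of `V^s` under `WL.pair`. For `s ≥ 0`, `V^s = D(L^{s/2})`. -/
abbrev V (s : ℝ) : Type := WL (E.wt s)

theorem wt_le {s r : ℝ} (h : s ≤ r) :
    ∃ C : ℝ, ∀ i, (E.wt s i : ℝ) ≤ C * E.wt r i := by
  obtain ⟨c, hc, hle⟩ := E.bddBelow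
  refine ⟨c ^ (s - r), fun i => ?_⟩
  have h1 : E.ev i ^ s = E.ev i ^ (s - r) * E.ev i ^ r := by
    rw [← Real.rpow_add (E.ev_pos i), sub_add_cancel]
  change E.ev i ^ s ≤ c ^ (s - r) * E.ev i ^ r
  rw [h1]
  exact mul_le_mul_of_nonneg_right
    (Real.rpow_le_rpow_of_nonpos hc (hle i) (by linarith)) (Real.rpow_pos_of_pos (E.ev_pos i) r).le

/-- The embedding `V^r ⊆ V^s`, `s ≤ r`. -/
def emb {s r : ℝ} (h : s ≤ r) : E.V r →L[ℝ] E.V s :=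
  WL.pull id Function.injective_id (E.wt_le h)

/-- `σ(λ_i) = λ_{i₁} + ⋯ + λ_{iₖ}`; here the multi-index `i` has `k = n + 1` entries. -/
def sig {n : ℕ} (i : Fin (n + 1) → ℕ) : ℝ := ∑ l, E.ev (i l)

/-- `π(λ_i) = λ_{i₁} ⋯ λ_{iₖ}`. -/
def pr {n : ℕ} (i : Fin (n + 1) → ℕ) : ℝ := ∏ l, E.ev (i l)

theorem ev_le_sig {n : ℕ} (i : Fin (n + 1) → ℕ) (l : Fin (n + 1)) : E.ev (i l) ≤ E.sig i :=
  Finset.single_le_sum (f := fun l => E.ev (i l)) (fun m _ => (E.ev_pos (i m)).le)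
    (Finset.mem_univ l)

theorem sig_pos {n : ℕ} (i : Fin (n + 1) → ℕ) : 0 < E.sig i :=
  (E.ev_pos (i 0)).trans_le (E.ev_le_sig i 0)

theorem pr_pos {n : ℕ} (i : Fin (n + 1) → ℕ) : 0 < E.pr i :=
  Finset.prod_pos fun l _ => E.ev_pos (i l)

/-- The weight `π(λ_i) ^ α * σ(λ_i) ^ q`. -/
def wtT (α q : ℝ) (n : ℕ) : Weight (Fin (n + 1) → ℕ) := fun i =>
  ⟨E.pr i ^ α * E.sig i ^ q,
    mul_pos (Real.rpow_pos_of_pos (E.pr_pos i) α) (Real.rpow_pos_of_pos (E.sig_pos i) q)⟩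

/-- The tensor space `V^α_q(k)` for `k = n + 1`, with
`‖v‖² = ∑ i ∈ ℕ^k, π(λ_i) ^ α * σ(λ_i) ^ q * ⟨v, φ_i⟩²`. In particular `VT 0 0 n` is `H(n + 1)`. -/
abbrev VT (α q : ℝ) (n : ℕ) : Type := WL (E.wtT α q n)

/-- The embedding `V_1^0(k) ⊆ H(k)`. -/
def embT (n : ℕ) : E.VT 0 1 n →L[ℝ] E.VT 0 0 n :=
  WL.pull id Function.injective_id (by
    obtain ⟨c, hc, hle⟩ := E.bddBelow
    refine ⟨c⁻¹, fun i => ?_⟩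
    have h : c ≤ E.sig i := (hle (i 0)).trans (E.ev_le_sig i 0)
    simp only [wtT, id, Real.rpow_zero, Real.rpow_one, one_mul]
    rw [inv_mul_eq_div, le_div_iff₀ hc, one_mul]
    exact h)

/-- For fixed `j` and `l`, the element `∑ p, u(j₁, …, p, …, jₖ) φ_p` of `V`, where `p` stands at
place `l`. -/
def slice {n : ℕ} (u : E.VT 0 1 n) (j : Fin (n + 1) → ℕ) (l : Fin (n + 1)) : E.V 1 :=
  WL.pull (fun p => Function.update j l p) (Function.update_injective j l) (by
    refine ⟨1, fun p => ?_⟩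
    have h := E.ev_le_sig (Function.update j l p) l
    simpa [wt, wtT] using h) u

/-- The multi-index `(j₁, …, j_{l-1}, p, r, j_{l+1}, …, jₖ)`, where `(p, r) = m`. -/
def replace2 {n : ℕ} (j : Fin (n + 1) → ℕ) (l : Fin (n + 1)) (m : Fin 2 → ℕ) :
    Fin (n + 2) → ℕ :=
  Fin.insertNth (α := fun _ => ℕ) l.castSucc (m 0) (Function.update j l (m 1))

theorem replace2_injective {n : ℕ} (j : Fin (n + 1) → ℕ) (l : Fin (n + 1)) :
    Function.Injective (replace2 j l) := by
  intro m m' h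
  have h0 := congrFun h l.castSucc
  have h1 := congrFun h (l.castSucc.succAbove l)
  simp only [replace2, Fin.insertNth_apply_same, Fin.insertNth_apply_succAbove,
    Function.update_self] at h0 h1
  funext i
  fin_cases i
  · exact h0
  · exact h1

/-- For fixed `j` and `l`, the element `∑ p r, u(j₁, …, p, r, …, jₖ) φ_p ⊗ φ_r` of `V_1^0(2)`,
where `p, r` replace the entry at place `l`. -/
def slice2 {n : ℕ} (u : E.VT 0 1 (n + 1)) (j : Fin (n + 1) → ℕ) (l : Fin (n + 1)) :
    E.VT 0 1 1 :=
  WL.pull (replace2 j l) (replace2_injective j l) (by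
    refine ⟨1, fun m => ?_⟩
    have hs : E.sig (replace2 j l m) = E.ev (m 0) + ∑ i, E.ev (Function.update j l (m 1) i) := by
      unfold sig
      rw [Fin.sum_univ_succAbove _ l.castSucc]
      simp [replace2]
    have hl : E.ev (m 1) ≤ ∑ i, E.ev (Function.update j l (m 1) i) := by
      have := E.ev_le_sig (Function.update j l (m 1)) l
      simpa [sig] using this
    have h2 : E.sig m = E.ev (m 0) + E.ev (m 1) := by simp [sig, Fin.sum_univ_two]
    simp only [wtT, Real.rpow_zero, Real.rpow_one, one_mul]
    rw [hs, h2]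
    linarith) u

/-! ### Kronecker sums -/

/-- Coefficients of `A_k u = ∑ l, (I ⊗ ⋯ ⊗ A ⊗ ⋯ ⊗ I) u`, for `k = n + 1`: the summand `l` applies
`A : V → V'` in the `l`-th variable. -/
def kronA (A : E.V 1 →L[ℝ] E.V (-1)) {n : ℕ} (u : E.VT 0 1 n) (j : Fin (n + 1) → ℕ) : ℝ :=
  ∑ l, A (E.slice u j l) (j l)

/-- Coefficients of `B_k u = ∑ l, (I ⊗ ⋯ ⊗ B ⊗ ⋯ ⊗ I) u`, for `k = n + 1` and `u` of order `k + 1`: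
the summand `l` applies `B : V_1^0(2) → V'` in the variables `l` and `l + 1`. -/
def kronB (B : E.VT 0 1 1 →L[ℝ] E.V (-1)) {n : ℕ} (u : E.VT 0 1 (n + 1))
    (j : Fin (n + 1) → ℕ) : ℝ :=
  ∑ l, B (E.slice2 u j l) (j l)

/-- Coefficients of `F_k u = ∑ l, (I ⊗ ⋯ ⊗ (-f) ⊗ ⋯ ⊗ I) u`, for `k = n + 2` and `u` of order
`k - 1`: the summand `l` inserts `-f` as the `l`-th factor. -/
def kronF (f : E.V 0) {n : ℕ} (u : E.VT 0 1 n) (j : Fin (n + 2) → ℕ) : ℝ :=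
  ∑ l : Fin (n + 2), (-f (j l)) * u (l.removeNth j)

/-- The rows of the block tridiagonal matrix with `A_k` on the diagonal, `B_k` above it and `F_k`
below it. Row `n` is the equation for the moment of order `n + 1`. -/
def row (A : E.V 1 →L[ℝ] E.V (-1)) (B : E.VT 0 1 1 →L[ℝ] E.V (-1)) (f : E.V 0)
    (u : ∀ n, E.VT 0 1 n) : ∀ n, (Fin (n + 1) → ℕ) → ℝ
  | 0 => fun j => E.kronA A (u 0) j + E.kronB B (u 1) j
  | n + 1 => fun j => E.kronF f (u n) j + E.kronA A (u (n + 1)) j + E.kronB B (u (n + 2)) j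

/-- The space `U^0_q(N)`, the Hilbert sum of the `V^0_q(k)` for `k = 1, …, N`. -/
abbrev U (q : ℝ) (N : ℕ) : Type := PiLp 2 fun n : Fin N => E.VT 0 q n

/-- Extension of a vector of `N` moments by `0`. -/
def extend {N : ℕ} (u : E.U 1 N) (n : ℕ) : E.VT 0 1 n :=
  if h : n < N then u ⟨n, h⟩ else 0

/-- The square of the norm of `Y(N) = H(1) ⊕ ⋯ ⊕ H(N)`. -/
def normSqY {N : ℕ} (v : E.U 1 N) : ℝ := ∑ n : Fin N, ‖E.embT n (v n)‖ ^ 2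

/-- The duality pairing between `U_{-1}^0(N)` and `U_1^0(N)`. -/
def pairU {N : ℕ} (g : E.U (-1) N) (v : E.U 1 N) : ℝ := ∑ n : Fin N, WL.pair (g n) (v n)

/-! ### Fractional powers of `A_λ = A + λ` -/

/-- The resolvent `(t + A_λ)⁻¹`, as a bounded operator on `V'`. -/
def resolvent (A : E.V 1 →L[ℝ] E.V (-1)) (lam t : ℝ) : E.V (-1) →L[ℝ] E.V (-1) :=
  (E.emb (by norm_num : (-1 : ℝ) ≤ 1)).comp
    (A + (t + lam) • E.emb (by norm_num : (-1 : ℝ) ≤ 1)).inverse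

/-- The negative power `A_λ ^ (-s)`, `s ≥ 0`, as a bounded operator on `V'`: it is the identity for
`s = 0`, and for `s > 0` it is given by the formula of Balakrishnan and Komatsu
`A_λ ^ (-s) = Γ(m) / (Γ(s) Γ(m - s)) * ∫_0^∞ t ^ (m - s - 1) (t + A_λ) ^ (-m) dt`
with an integer `m > s` (the value does not depend on `m`). -/
def negPow (A : E.V 1 →L[ℝ] E.V (-1)) (lam s : ℝ) : E.V (-1) →L[ℝ] E.V (-1) :=
  if s = 0 then ContinuousLinearMap.id ℝ _
  else
    (Real.Gamma ((⌊s⌋₊ + 1 : ℕ) : ℝ) /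
        (Real.Gamma s * Real.Gamma (((⌊s⌋₊ + 1 : ℕ) : ℝ) - s))) •
      ∫ t in Set.Ioi (0 : ℝ),
        t ^ (((⌊s⌋₊ + 1 : ℕ) : ℝ) - s - 1) • (E.resolvent A lam t) ^ (⌊s⌋₊ + 1)

/-- The domain `D(A_λ ^ s)`, `s ≥ 0`, of the power of the realization of `A_λ` in `H`: it is the
range of `A_λ ^ (-s)` on `H`. -/
def domPow (A : E.V 1 →L[ℝ] E.V (-1)) (lam s : ℝ) : Set (ℕ → ℝ) :=
  {x | ∃ (h : E.V 0) (y : E.V (-1)), (∀ i, y i = h i) ∧ x = E.negPow A lam s y}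

/-- The domain `D(L ^ s)`, `s ≥ 0`, in `H`. -/
def domL (s : ℝ) : Set (ℕ → ℝ) := {x | ∃ y : E.V (2 * s), x = y}

/-- `S : V^a → V^b` is the operator `A_λ ^ s = (A_λ ^ (-s))⁻¹`, where `s ≥ 0`. -/
def IsPow (A : E.V 1 →L[ℝ] E.V (-1)) (lam s : ℝ) {a b : ℝ} (S : E.V a →L[ℝ] E.V b) : Prop :=
  ∀ x : E.V a, ∃ y : E.V (-1), (∀ i, y i = S x i) ∧ ∀ i, E.negPow A lam s y i = x i

/-- `P : V_1^0(2) → V_1^α(2)` is the operator `A_λ ^ (-s) ⊗ A_λ ^ (-s)`: it maps `x ⊗ y` to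
`A_λ ^ (-s) x ⊗ A_λ ^ (-s) y` for `x, y ∈ V`. -/
def IsTensorPow (A : E.V 1 →L[ℝ] E.V (-1)) (lam s : ℝ) {α : ℝ}
    (P : E.VT 0 1 1 →L[ℝ] E.VT α 1 1) : Prop :=
  ∀ (x y : E.V 1) (z : E.VT 0 1 1), (∀ i, z i = x (i 0) * y (i 1)) →
    ∀ i, P z i = E.negPow A lam s (E.emb (by norm_num : (-1 : ℝ) ≤ 1) x) (i 0) *
      E.negPow A lam s (E.emb (by norm_num : (-1 : ℝ) ≤ 1) y) (i 1)

end EigenSystem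

/-- The bounded operator that is singled out by the property `p` (`0` if there is none). -/
def opOf {X Y : Type} [NormedAddCommGroup X] [NormedSpace ℝ X] [NormedAddCommGroup Y]
    [NormedSpace ℝ Y] (p : (X →L[ℝ] Y) → Prop) : X →L[ℝ] Y :=
  open Classical in if h : ∃ S, p S then h.choose else 0

/-- The norm in `[0, ∞]` of the operator that is singled out by the property `p`: it is `∞` if there
is no bounded operator with this property. -/
def normOf {X Y : Type} [NormedAddCommGroup X] [NormedSpace ℝ X] [NormedAddCommGroup Y]
    [NormedSpace ℝ Y] (p : (X →L[ℝ] Y) → Prop) : ℝ≥0∞ :=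
  open Classical in if ∃ S, p S then ‖opOf p‖ₑ else ⊤

/-- Lebesgue measure on the time interval `(0, T)`, where `T` may be `∞`. -/
def timeMeasure (T : EReal) : Measure ℝ := volume.restrict {t : ℝ | 0 < t ∧ (t : EReal) < T}

namespace EigenSystem

variable (E : EigenSystem)

/-! ### The transformed operator and its constants -/

/-- `B̃ = A_λ^{α/2} B (A_λ^{-α/2} ⊗ A_λ^{-α/2})`, as an operator `V_1^0(2) → V'`. -/
def liftB (A : E.V 1 →L[ℝ] E.V (-1)) (lam α : ℝ) (B : E.VT α 1 1 →L[ℝ] E.V (α - 1)) :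
    E.VT 0 1 1 →L[ℝ] E.V (-1) :=
  (opOf fun S : E.V (α - 1) →L[ℝ] E.V (-1) => E.IsPow A lam (α / 2) S).comp
    (B.comp (opOf fun P : E.VT 0 1 1 →L[ℝ] E.VT α 1 1 => E.IsTensorPow A lam (α / 2) P))

/-- `f̃ = A_λ^{α/2} f ∈ H` for `f ∈ V^α`. -/
def liftF (A : E.V 1 →L[ℝ] E.V (-1)) (lam α : ℝ) (f : E.V α) : E.V 0 :=
  opOf (fun S : E.V α →L[ℝ] E.V 0 => E.IsPow A lam (α / 2) S) f

/-- The constant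
`c_{λ,α} = ‖A_λ^{α/2}‖_{L(V^{α-1}, V^{-1})} ‖A_λ^{-α/2} ⊗ A_λ^{-α/2}‖_{L(V_1^0(2), V_1^α(2))}`. -/
def cLam (A : E.V 1 →L[ℝ] E.V (-1)) (lam α : ℝ) : ℝ≥0∞ :=
  normOf (fun S : E.V (α - 1) →L[ℝ] E.V (-1) => E.IsPow A lam (α / 2) S) *
    normOf (fun P : E.VT 0 1 1 →L[ℝ] E.VT α 1 1 => E.IsTensorPow A lam (α / 2) P)

/-- The constant `‖A_λ^{α/2} L^{-α/2}‖_{L(H, H)} = ‖A_λ^{α/2}‖_{L(V^α, H)}`. -/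
def cLamTilde (A : E.V 1 →L[ℝ] E.V (-1)) (lam α : ℝ) : ℝ≥0∞ :=
  normOf fun S : E.V α →L[ℝ] E.V 0 => E.IsPow A lam (α / 2) S

/-- The constant `√2 c_{λ,α} c_B` that bounds the upper diagonal blocks. -/
def cUpper (A : E.V 1 →L[ℝ] E.V (-1)) (lam α cB : ℝ) : ℝ≥0∞ :=
  ENNReal.ofReal (Real.sqrt 2) * E.cLam A lam α * ENNReal.ofReal cB

/-- The constant `√2 ‖A_λ^{α/2} L^{-α/2}‖ / λ_min` that bounds the lower diagonal blocks. -/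
def cLower (A : E.V 1 →L[ℝ] E.V (-1)) (lam α : ℝ) : ℝ≥0∞ :=
  ENNReal.ofReal (Real.sqrt 2 / E.evMin) * E.cLamTilde A lam α

/-- The constant `c_P = √2 c_{λ,α} c_B + (√2 ‖A_λ^{α/2} L^{-α/2}‖ / λ_min) ‖f‖_{L^∞(0, T; V^α)}`. -/
def cP (A : E.V 1 →L[ℝ] E.V (-1)) (lam α cB : ℝ) (T : EReal) (f : ℝ → E.V α) : ℝ≥0∞ :=
  E.cUpper A lam α cB + E.cLower A lam α * eLpNorm f ⊤ (timeMeasure T)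

/-- `Ã : U_1^0(N) → U_{-1}^0(N)` is the transformed truncated Carleman block operator for the
forcing `f ∈ V^α` (at one time): the block tridiagonal operator with the blocks `A_k`, `B̃_k` and
`F̃_k`. -/
def IsCarleman (A : E.V 1 →L[ℝ] E.V (-1)) (lam α : ℝ) (B : E.VT α 1 1 →L[ℝ] E.V (α - 1))
    (f : E.V α) {N : ℕ} (At : E.U 1 N →L[ℝ] E.U (-1) N) : Prop :=
  ∀ (u : E.U 1 N) (n : Fin N) (j : Fin ((n : ℕ) + 1) → ℕ),
    At u n j = E.row A (E.liftB A lam α B) (E.liftF A lam α f) (E.extend u) n j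

end EigenSystem

end Carleman

end

open MeasureTheory Carleman

/-!
The operator is the sum of a block diagonal part (the Kronecker sums `A_k`), a part above the
diagonal (the `B̃_k`) and a part below it (the `F̃_k`). It suffices to bound every block
`V_1^0 → V_{-1}^0` uniformly in its order `k`, since a shift by one row has norm at most `1`, and
to show that each `A_k` is coercive.

The bounds for the blocks have a common source. If `a_l(j)`, `l = 1, …, k`, are the coefficients of
the summands of a Kronecker sum, then the Cauchy–Schwarz inequality with the weights `λ_{j_l}`,
whose sum over `l` is `σ(λ_j)`, yields
`∑ j, σ(λ_j)⁻¹ (∑ l, a_l(j))² ≤ ∑ l, ∑ j, λ_{j_l}⁻¹ a_l(j)²` (`kron_bound`). In the `l`-th term on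
the right the sum over the entry `j_l` is a squared norm in `V'`, so that the operator in the `l`-th
variable is estimated for fixed values of the other variables (`slot_bound`). What remains is to sum
the squared norms of the fibers that it acts on.

* For `A_k`, the fibers in the variable `l` contribute `∑ j, λ_{j_l} u(j)²`, and the sum over `l` is
  `‖u‖²`. So `A_k` has the bound `β` of `A` (`kronA_bound`). The same slicing, applied to the form
  of `A`, shows that `A_k` is coercive up to `k λ ‖u‖²` in the norm of `H(k)` (`kronA_coercive`).
* For `B̃_k`, the fibers in the variables `l, l + 1` contribute
  `∑ i, (λ_{i_l} + λ_{i_{l+1}}) u(i)²`, and the sum over `l` is at most `2 ‖u‖²`. This is the factor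
  `√2` (`kronB_bound`).
* For `F̃_k`, every one of the `k` summands has the squared norm at most `λ_min⁻¹ ‖f̃‖² ‖u‖²_H`, and
  `‖u‖²_H ≤ ((k - 1) λ_min)⁻¹ ‖u‖²`; here `k / (k - 1) ≤ 2` (`kronF_bound`).

The norms of `B̃` and `f̃` are bounded by the factors of `c_P` (`offDiagonal_le_cP`), where
`‖f(t)‖` is at most the essential supremum for almost every `t`.
-/

open scoped ENNReal NNReal

namespace Carleman

/-! ### Weighted spaces and their pairing -/

namespace WL

variable {ι ρ : Type} {w w' : Weight ι}

theorem hasSum_norm_sq (x : WL w) : HasSum (fun i => (w i : ℝ) * x i ^ 2) (‖x‖ ^ 2) := by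
  rw [norm_sq]
  exact x.summable.hasSum

theorem weighted_nonneg (x : WL w) (i : ι) : 0 ≤ (w i : ℝ) * x i ^ 2 :=
  mul_nonneg (w i).2.le (sq_nonneg _)

/-- A family of vectors of `ℓ²(w)` with square summable norms is the same as an element of `ℓ²` on
the product of the index sets. -/
theorem hasSum_prod_iff {x : ρ → WL w} {s : ℝ} :
    HasSum (fun z : ρ × ι => (w z.2 : ℝ) * x z.1 z.2 ^ 2) s ↔
      HasSum (fun r => ‖x r‖ ^ 2) s := by
  refine ⟨fun h => h.prod_fiberwise fun r => (x r).hasSum_norm_sq, fun h => ?_⟩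
  have hs : Summable fun z : ρ × ι => (w z.2 : ℝ) * x z.1 z.2 ^ 2 := by
    refine (summable_prod_of_nonneg fun z => weighted_nonneg (x z.1) z.2).2
      ⟨fun r => (x r).summable, h.summable.congr fun r => norm_sq (x r)⟩
  have h2 := hs.hasSum.prod_fiberwise fun r => (x r).hasSum_norm_sq
  rw [h.unique h2]
  exact hs.hasSum

/-- The weights `w` and `w'` are inverse to each other, so that `WL.pair` is a duality pairing. -/
def Dual (w' w : Weight ι) : Prop := ∀ i, (w' i : ℝ) = (w i : ℝ)⁻¹

theorem two_abs_mul_le {a b r : ℝ} (hr : 0 < r) : |a * b| ≤ (r⁻¹ * a ^ 2 + r * b ^ 2) / 2 := by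
  have h : r⁻¹ * a ^ 2 = r * (r⁻¹ * a) ^ 2 := by field_simp
  have h2 : a * b = r * ((r⁻¹ * a) * b) := by field_simp
  rw [h, h2, abs_mul, abs_of_pos hr, ← mul_add, mul_div_assoc]
  refine mul_le_mul_of_nonneg_left ?_ hr.le
  rw [abs_le]
  constructor <;> nlinarith [sq_nonneg (r⁻¹ * a + b), sq_nonneg (r⁻¹ * a - b)]

theorem summable_pair (hw : Dual w' w) (x : WL w') (y : WL w) :
    Summable fun i => x i * y i := by
  refine Summable.of_norm_bounded ((x.summable.add y.summable).div_const 2) fun i => ?_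
  rw [hw i]
  exact two_abs_mul_le (w i).2

theorem pair_add_left (hw : Dual w' w) (x x' : WL w') (y : WL w) :
    pair (x + x') y = pair x y + pair x' y := by
  unfold pair
  rw [← (summable_pair hw x y).tsum_add (summable_pair hw x' y)]
  exact tsum_congr fun i => by simp [add_mul]

theorem pair_smul_left (c : ℝ) (x : WL w') (y : WL w) : pair (c • x) y = c * pair x y := by
  unfold pair
  rw [← tsum_mul_left]
  exact tsum_congr fun i => by simp [mul_assoc]

theorem abs_pair_le (hw : Dual w' w) (x : WL w') (y : WL w) : |pair x y| ≤ ‖x‖ * ‖y‖ := by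
  -- the inequality of arithmetic and geometric means, scaled by `‖y‖` and `‖x‖`
  have key : ∀ x : WL w', ∀ y : WL w, |pair x y| ≤ (‖x‖ ^ 2 + ‖y‖ ^ 2) / 2 := fun x y => by
    have hs := (x.hasSum_norm_sq.add y.hasSum_norm_sq).div_const 2
    rw [← Real.norm_eq_abs]
    refine tsum_of_norm_bounded hs fun i => ?_
    rw [hw i]
    exact two_abs_mul_le (w i).2
  have hsymm : ∀ c : ℝ, pair x (c • y) = c * pair x y := fun c => by
    unfold pair
    rw [← tsum_mul_left]
    exact tsum_congr fun i => by simp; ring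
  rcases eq_or_ne x 0 with rfl | hx
  · simp [pair]
  rcases eq_or_ne y 0 with rfl | hy
  · simp [pair]
  have hx' := norm_pos_iff.2 hx
  have hy' := norm_pos_iff.2 hy
  have h := key (‖x‖⁻¹ • x) (‖y‖⁻¹ • y)
  rw [pair_smul_left, hsymm, norm_smul, norm_smul, norm_inv, norm_inv, norm_norm, norm_norm,
    inv_mul_cancel₀ hx'.ne', inv_mul_cancel₀ hy'.ne', abs_mul, abs_mul,
    abs_of_pos (inv_pos.2 hx'), abs_of_pos (inv_pos.2 hy')] at h
  norm_num at h
  rw [← mul_assoc, ← mul_inv, inv_mul_eq_div, div_le_one (by positivity)] at h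
  linarith

/-- The Riesz representative: every `x ∈ ℓ²(1/w)` has a `y ∈ ℓ²(w)` of the same norm with
`⟨x, y⟩ = ‖x‖²`. -/
theorem exists_pair_eq_norm_sq (hw : Dual w' w) (x : WL w') :
    ∃ y : WL w, ‖y‖ = ‖x‖ ∧ pair x y = ‖x‖ ^ 2 := by
  have h : ∀ i, (w i : ℝ) * ((w' i : ℝ) * x i) ^ 2 = (w' i : ℝ) * x i ^ 2 := fun i => by
    rw [hw i]
    have := (w i).2.ne'
    field_simp
  have hs : HasSum (fun i => (w i : ℝ) * ((w' i : ℝ) * x i) ^ 2) (‖x‖ ^ 2) := by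
    simpa only [h] using x.hasSum_norm_sq
  let y : WL w := ⟨fun i => (w' i : ℝ) * x i, hs.summable⟩
  have hy : ‖y‖ ^ 2 = ‖x‖ ^ 2 := y.hasSum_norm_sq.unique hs
  refine ⟨y, (sq_eq_sq₀ (norm_nonneg _) (norm_nonneg _)).1 hy, ?_⟩
  rw [norm_sq]
  exact tsum_congr fun i => by change x i * ((w' i : ℝ) * x i) = _; ring

end WL

/-- A linear map into families of coefficients whose weighted square sums are bounded takes its values
in `ℓ²(w)`. -/
theorem WL.exists_operator {ι X : Type} [NormedAddCommGroup X] [NormedSpace ℝ X] {w : Weight ι}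
    (c : X →ₗ[ℝ] (ι → ℝ)) {C : ℝ} (hC : 0 ≤ C)
    (h : ∀ x, ∃ s ≤ C ^ 2 * ‖x‖ ^ 2, HasSum (fun i => (w i : ℝ) * c x i ^ 2) s) :
    ∃ S : X →ₗ[ℝ] WL w, (∀ x i, S x i = c x i) ∧ ∀ x, ‖S x‖ ≤ C * ‖x‖ := by
  have hs : ∀ x, Summable fun i => (w i : ℝ) * c x i ^ 2 := fun x => by
    obtain ⟨s, -, hs⟩ := h x
    exact hs.summable
  let S : X →ₗ[ℝ] WL w :=
    { toFun := fun x => ⟨c x, hs x⟩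
      map_add' := fun x y => Subtype.ext (c.map_add x y)
      map_smul' := fun r x => Subtype.ext (c.map_smul r x) }
  refine ⟨S, fun _ _ => rfl, fun x => ?_⟩
  obtain ⟨s, hle, hs⟩ := h x
  refine (sq_le_sq₀ (norm_nonneg _) (mul_nonneg hC (norm_nonneg _))).1 ?_
  rw [mul_pow, (S x).hasSum_norm_sq.unique hs]
  exact hle

/-- It need not be known that an operator with the property `p` exists: if there is none, then
`opOf p = 0` and `normOf p = ∞`. -/
theorem enorm_opOf_le {X Y : Type} [NormedAddCommGroup X] [NormedSpace ℝ X]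
    [NormedAddCommGroup Y] [NormedSpace ℝ Y] (p : (X →L[ℝ] Y) → Prop) :
    ‖opOf p‖ₑ ≤ normOf p := by
  unfold normOf
  split_ifs
  exacts [le_rfl, le_top]

namespace EigenSystem

variable (E : EigenSystem)

/-! ### Weights and the bottom of the spectrum -/

theorem wt_one (i : ℕ) : (E.wt 1 i : ℝ) = E.ev i := Real.rpow_one _

theorem wt_neg_one (i : ℕ) : (E.wt (-1) i : ℝ) = (E.ev i)⁻¹ := Real.rpow_neg_one _

theorem wt_zero (i : ℕ) : (E.wt 0 i : ℝ) = 1 := Real.rpow_zero _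

theorem wtT_one {n : ℕ} (j : Fin (n + 1) → ℕ) : (E.wtT 0 1 n j : ℝ) = E.sig j := by
  simp [wtT]

theorem wtT_neg_one {n : ℕ} (j : Fin (n + 1) → ℕ) : (E.wtT 0 (-1) n j : ℝ) = (E.sig j)⁻¹ := by
  simp [wtT, Real.rpow_neg_one]

theorem wtT_zero {n : ℕ} (j : Fin (n + 1) → ℕ) : (E.wtT 0 0 n j : ℝ) = 1 := by
  simp [wtT]

theorem dual_wt : WL.Dual (E.wt (-1)) (E.wt 1) := fun i => by rw [wt_one, wt_neg_one]

theorem dual_wtT (n : ℕ) : WL.Dual (E.wtT 0 (-1) n) (E.wtT 0 1 n) := fun i => by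
  rw [wtT_one, wtT_neg_one]

theorem evMin_le (i : ℕ) : E.evMin ≤ E.ev i := by
  obtain ⟨c, -, h⟩ := E.bddBelow
  exact ciInf_le ⟨c, by rintro _ ⟨j, rfl⟩; exact h j⟩ i

theorem evMin_pos : 0 < E.evMin := by
  obtain ⟨c, hc, h⟩ := E.bddBelow
  exact hc.trans_le (le_ciInf h)

theorem evMin_mul_le_sig {n : ℕ} (j : Fin (n + 1) → ℕ) : (n + 1) * E.evMin ≤ E.sig j := by
  have h := Finset.sum_le_sum (s := Finset.univ) fun (l : Fin (n + 1)) _ => E.evMin_le (j l)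
  simpa [sig] using h

theorem norm_emb_sq_le (x : E.V 0) :
    ‖E.emb (by norm_num : (-1 : ℝ) ≤ 0) x‖ ^ 2 ≤ E.evMin⁻¹ * ‖x‖ ^ 2 := by
  refine hasSum_le (fun i => ?_) (WL.hasSum_norm_sq _) (x.hasSum_norm_sq.mul_left _)
  change (E.wt (-1) i : ℝ) * x i ^ 2 ≤ _
  rw [wt_neg_one, wt_zero, one_mul]
  exact mul_le_mul_of_nonneg_right (inv_anti₀ E.evMin_pos (E.evMin_le i)) (sq_nonneg _)

/-! ### Kronecker sums -/

/-- A multi-index of length `n + 1` is its entry at place `l` together with the other entries. -/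
def slotEquiv {n : ℕ} (l : Fin (n + 1)) : (Fin n → ℕ) × ℕ ≃ (Fin (n + 1) → ℕ) :=
  (Equiv.prodComm _ _).trans (Fin.insertNthEquiv (fun _ => ℕ) l)

theorem slotEquiv_apply {n : ℕ} (l : Fin (n + 1)) (z : (Fin n → ℕ) × ℕ) :
    slotEquiv l z = Fin.insertNth (α := fun _ => ℕ) l z.2 z.1 := rfl

theorem slotEquiv_apply_self {n : ℕ} (l : Fin (n + 1)) (z : (Fin n → ℕ) × ℕ) :
    slotEquiv l z l = z.2 := by
  rw [slotEquiv_apply, Fin.insertNth_apply_same]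

theorem removeNth_slotEquiv {n : ℕ} (l : Fin (n + 1)) (z : (Fin n → ℕ) × ℕ) :
    l.removeNth (slotEquiv l z) = z.1 := by
  rw [slotEquiv_apply, Fin.removeNth_insertNth]

/-- If an operator with values in `V'` is applied in the `l`-th variable, the squares of the
coefficients of the result are summable with the weight `1 / λ_{j_l}`. Here `x r` is the vector that
the operator acts on when the other variables are `r`. -/
theorem slot_bound {κ : Type} {w : Weight κ} {n : ℕ} (l : Fin (n + 1)) (S : WL w →L[ℝ] E.V (-1))
    {C s : ℝ} (hS : ∀ x, ‖S x‖ ^ 2 ≤ C * ‖x‖ ^ 2) {x : (Fin n → ℕ) → WL w}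
    (hx : HasSum (fun r => ‖x r‖ ^ 2) s) :
    ∃ s' ≤ C * s,
      HasSum (fun j : Fin (n + 1) → ℕ => (E.ev (j l))⁻¹ * S (x (l.removeNth j)) (j l) ^ 2) s' := by
  have hsum : Summable fun r => ‖S (x r)‖ ^ 2 :=
    Summable.of_nonneg_of_le (fun r => sq_nonneg _) (fun r => hS (x r)) (hx.summable.mul_left C)
  refine ⟨∑' r, ‖S (x r)‖ ^ 2, hasSum_le (fun r => hS (x r)) hsum.hasSum (hx.mul_left C), ?_⟩
  have h := WL.hasSum_prod_iff.2 hsum.hasSum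
  rw [← (slotEquiv l).hasSum_iff]
  convert h using 2 with z
  rw [Function.comp_apply, slotEquiv_apply_self, removeNth_slotEquiv, wt_neg_one]

/-- Cauchy–Schwarz with the weights `λ_{j_l}`, whose sum over `l` is `σ(λ_j)`. -/
theorem kron_bound {n : ℕ} {a : Fin (n + 1) → (Fin (n + 1) → ℕ) → ℝ} {s : Fin (n + 1) → ℝ}
    (ha : ∀ l, HasSum (fun j => (E.ev (j l))⁻¹ * a l j ^ 2) (s l)) :
    ∃ s' ≤ ∑ l, s l, HasSum (fun j => (E.wtT 0 (-1) n j : ℝ) * (∑ l, a l j) ^ 2) s' := by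
  have h := hasSum_sum fun l (_ : l ∈ Finset.univ) => ha l
  have hle : ∀ j : Fin (n + 1) → ℕ, (E.wtT 0 (-1) n j : ℝ) * (∑ l, a l j) ^ 2 ≤
      ∑ l, (E.ev (j l))⁻¹ * a l j ^ 2 := fun j => by
    rw [wtT_neg_one, inv_mul_le_iff₀ (E.sig_pos j)]
    refine Finset.sum_sq_le_sum_mul_sum_of_sq_le_mul _ (fun l _ => (E.ev_pos (j l)).le)
      (fun l _ => mul_nonneg (inv_nonneg.2 (E.ev_pos (j l)).le) (sq_nonneg _)) fun l _ => ?_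
    rw [mul_inv_cancel_left₀ (E.ev_pos (j l)).ne']
  have hs : Summable fun j => (E.wtT 0 (-1) n j : ℝ) * (∑ l, a l j) ^ 2 :=
    Summable.of_nonneg_of_le (fun j => mul_nonneg (E.wtT 0 (-1) n j).2.le (sq_nonneg _)) hle
      h.summable
  exact ⟨_, hasSum_le hle hs.hasSum h, hs.hasSum⟩

/-- The part of `u` in the `l`-th variable, for fixed values `r` of the other variables. The
entry `0` at place `l` is a placeholder that `slice` overwrites. -/
noncomputable def fiber {n : ℕ} (u : E.VT 0 1 n) (l : Fin (n + 1)) (r : Fin n → ℕ) : E.V 1 :=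
  E.slice u (slotEquiv l (r, 0)) l

theorem fiber_apply {n : ℕ} (u : E.VT 0 1 n) (l : Fin (n + 1)) (r : Fin n → ℕ) (q : ℕ) :
    E.fiber u l r q = u (slotEquiv l (r, q)) := by
  change u (Function.update (Fin.insertNth (α := fun _ => ℕ) l 0 r) l q) = _
  rw [Fin.update_insertNth]
  rfl

theorem slice_eq_fiber {n : ℕ} (u : E.VT 0 1 n) (j : Fin (n + 1) → ℕ) (l : Fin (n + 1)) :
    E.slice u j l = E.fiber u l (l.removeNth j) := by
  obtain ⟨z, rfl⟩ := (slotEquiv l).surjective j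
  ext q
  rw [removeNth_slotEquiv, fiber_apply]
  change u (Function.update (Fin.insertNth (α := fun _ => ℕ) l z.2 z.1) l q) = _
  rw [Fin.update_insertNth]
  rfl

/-- The squared norm of `V_1^0(k)` is a sum over the variables `l`, in each of which the weight is
the one of `V`. -/
theorem exists_hasSum_slot {n : ℕ} (u : E.VT 0 1 n) :
    ∃ s : Fin (n + 1) → ℝ, (∀ l, HasSum (fun j => E.ev (j l) * u j ^ 2) (s l)) ∧
      ∑ l, s l = ‖u‖ ^ 2 := by
  have hs : ∀ l, Summable fun j : Fin (n + 1) → ℕ => E.ev (j l) * u j ^ 2 := fun l =>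
    Summable.of_nonneg_of_le (fun j => mul_nonneg (E.ev_pos _).le (sq_nonneg _))
      (fun j => mul_le_mul_of_nonneg_right ((E.ev_le_sig j l).trans_eq (E.wtT_one j).symm)
        (sq_nonneg _)) u.summable
  refine ⟨fun l => ∑' j : Fin (n + 1) → ℕ, E.ev (j l) * u j ^ 2, fun l => (hs l).hasSum, ?_⟩
  refine (hasSum_sum fun l (_ : l ∈ Finset.univ) => (hs l).hasSum).unique ?_
  convert u.hasSum_norm_sq using 2 with j
  rw [wtT_one, sig, Finset.sum_mul]

theorem hasSum_norm_fiber_sq {n : ℕ} {u : E.VT 0 1 n} {l : Fin (n + 1)} {s : ℝ}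
    (h : HasSum (fun j => E.ev (j l) * u j ^ 2) s) :
    HasSum (fun r => ‖E.fiber u l r‖ ^ 2) s := by
  rw [← WL.hasSum_prod_iff]
  rw [← (slotEquiv l).hasSum_iff] at h
  convert h using 2 with z
  rw [Function.comp_apply, slotEquiv_apply_self, wt_one, fiber_apply]

/-- The `H`-norm of a tensor is the `ℓ²`-sum of the `H`-norms of its fibers in any variable. -/
theorem hasSum_norm_emb_fiber_sq {n : ℕ} (u : E.VT 0 1 n) (l : Fin (n + 1)) :
    HasSum (fun r => ‖E.emb (zero_le_one : (0 : ℝ) ≤ 1) (E.fiber u l r)‖ ^ 2)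
      (‖E.embT n u‖ ^ 2) := by
  rw [← WL.hasSum_prod_iff]
  have h := (E.embT n u).hasSum_norm_sq
  rw [← (slotEquiv l).hasSum_iff] at h
  convert h using 2 with z
  rw [Function.comp_apply, wt_zero, wtT_zero]
  exact congrArg (fun y => 1 * y ^ 2) (E.fiber_apply u l z.1 z.2)

theorem kronA_bound (A : E.V 1 →L[ℝ] E.V (-1)) {β : ℝ} (hA : ∀ v, ‖A v‖ ≤ β * ‖v‖) {n : ℕ}
    (u : E.VT 0 1 n) :
    ∃ s ≤ β ^ 2 * ‖u‖ ^ 2,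
      HasSum (fun j => (E.wtT 0 (-1) n j : ℝ) * E.kronA A u j ^ 2) s := by
  obtain ⟨s, hs, hsu⟩ := E.exists_hasSum_slot u
  have hA2 : ∀ x, ‖A x‖ ^ 2 ≤ β ^ 2 * ‖x‖ ^ 2 := fun x => by
    rw [← mul_pow]
    exact pow_le_pow_left₀ (norm_nonneg _) (hA x) 2
  choose s' hs' hsum using fun l =>
    E.slot_bound l A hA2 (E.hasSum_norm_fiber_sq (hs l))
  obtain ⟨t, ht, h⟩ := E.kron_bound hsum
  refine ⟨t, ht.trans ?_, ?_⟩
  · rw [← hsu, Finset.mul_sum]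
    exact Finset.sum_le_sum fun l _ => hs' l
  · simpa only [kronA, slice_eq_fiber] using h

/-- The fibers in the variables `l` and `l + 1` exhaust the tensor; their squared norms sum up to
the part of the squared norm that belongs to these two variables. -/
theorem hasSum_norm_slice2_sq {n : ℕ} {u : E.VT 0 1 (n + 1)} {l : Fin (n + 1)} {s : ℝ}
    (h : HasSum (fun i => (E.ev (i l.castSucc) + E.ev (i l.succ)) * u i ^ 2) s) :
    HasSum (fun r => ‖E.slice2 u (slotEquiv l (r, 0)) l‖ ^ 2) s := by
  rw [← WL.hasSum_prod_iff]
  -- `(r, (p, q))` goes to the multi-index with `p, q` at the places `l, l + 1` and `r` elsewhere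
  let e : (Fin n → ℕ) × (Fin 2 → ℕ) ≃ (Fin (n + 2) → ℕ) :=
    (((Equiv.refl _).prodCongr ((finTwoArrowEquiv ℕ).trans (Equiv.prodComm _ _))).trans
      (Equiv.prodAssoc _ _ _).symm).trans
      (((slotEquiv l).prodCongr (Equiv.refl ℕ)).trans (slotEquiv l.castSucc))
  have he : ∀ z, e z = slotEquiv l.castSucc (slotEquiv l (z.1, z.2 1), z.2 0) := fun z => rfl
  rw [← e.hasSum_iff] at h
  convert h using 2 with z
  have h0 : e z l.castSucc = z.2 0 := by rw [he, slotEquiv_apply_self]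
  have h1 : e z l.succ = z.2 1 := by
    have := Fin.insertNth_apply_succAbove (α := fun _ => ℕ) l.castSucc (z.2 0)
      (slotEquiv l (z.1, z.2 1)) l
    rw [slotEquiv_apply_self, Fin.succAbove_castSucc_self] at this
    exact this
  have h2 : replace2 (slotEquiv l (z.1, 0)) l z.2 = e z := by
    rw [he, replace2, slotEquiv_apply l, slotEquiv_apply l, Fin.update_insertNth]
    rfl
  rw [Function.comp_apply, h0, h1, wtT_one, sig, Fin.sum_univ_two, ← h2]
  rfl

theorem slice2_eq {n : ℕ} (u : E.VT 0 1 (n + 1)) (j : Fin (n + 1) → ℕ) (l : Fin (n + 1)) :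
    E.slice2 u j l = E.slice2 u (slotEquiv l (l.removeNth j, 0)) l := by
  obtain ⟨z, rfl⟩ := (slotEquiv l).surjective j
  ext m
  rw [removeNth_slotEquiv]
  change u (replace2 _ l m) = u (replace2 _ l m)
  simp only [replace2, slotEquiv_apply, Fin.update_insertNth]

/-- Each variable belongs to at most two pairs of neighbours, which is where the factor `2` comes
from. -/
theorem kronB_bound (B : E.VT 0 1 1 →L[ℝ] E.V (-1)) {b : ℝ} (hB : ∀ v, ‖B v‖ ≤ b * ‖v‖) {n : ℕ}
    (u : E.VT 0 1 (n + 1)) :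
    ∃ s ≤ (√2 * b) ^ 2 * ‖u‖ ^ 2,
      HasSum (fun j => (E.wtT 0 (-1) n j : ℝ) * E.kronB B u j ^ 2) s := by
  obtain ⟨s, hs, hsu⟩ := E.exists_hasSum_slot u
  have hs0 : ∀ l, 0 ≤ s l := fun l =>
    (hs l).nonneg fun j => mul_nonneg (E.ev_pos _).le (sq_nonneg _)
  have hB2 : ∀ x, ‖B x‖ ^ 2 ≤ b ^ 2 * ‖x‖ ^ 2 := fun x => by
    rw [← mul_pow]
    exact pow_le_pow_left₀ (norm_nonneg _) (hB x) 2
  choose s' hs' hsum using fun l : Fin (n + 1) =>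
    E.slot_bound l B hB2 (E.hasSum_norm_slice2_sq
      (((hs l.castSucc).add (hs l.succ)).congr_fun fun i => add_mul _ _ _))
  obtain ⟨t, ht, h⟩ := E.kron_bound hsum
  refine ⟨t, ht.trans ?_, ?_⟩
  · refine (Finset.sum_le_sum fun l _ => hs' l).trans ?_
    have h1 : ∑ l : Fin (n + 1), s l.castSucc ≤ ‖u‖ ^ 2 := by
      rw [← hsu, Fin.sum_univ_castSucc s]
      exact le_add_of_nonneg_right (hs0 _)
    have h2 : ∑ l : Fin (n + 1), s l.succ ≤ ‖u‖ ^ 2 := by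
      rw [← hsu, Fin.sum_univ_succ s]
      exact le_add_of_nonneg_left (hs0 _)
    rw [← Finset.mul_sum, Finset.sum_add_distrib, mul_pow, Real.sq_sqrt zero_le_two]
    nlinarith [sq_nonneg b]
  · simp only [← slice2_eq] at h
    exact h

theorem norm_embT_sq_le {n : ℕ} (u : E.VT 0 1 n) :
    ‖E.embT n u‖ ^ 2 ≤ ((n + 1) * E.evMin)⁻¹ * ‖u‖ ^ 2 := by
  have hpos : 0 < (n + 1) * E.evMin := mul_pos n.cast_add_one_pos E.evMin_pos
  refine hasSum_le (fun i => ?_) (WL.hasSum_norm_sq _) (u.hasSum_norm_sq.mul_left _)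
  rw [wtT_zero, wtT_one, ← mul_assoc]
  refine mul_le_mul_of_nonneg_right ?_ (sq_nonneg _)
  rw [inv_mul_eq_div, one_le_div hpos]
  exact E.evMin_mul_le_sig i

/-- Each of the `n + 2` insertions is bounded in terms of the `H`-norm of `u`, which is at most
`1 / √((n + 1) λ_min)` times the norm of `V_1^0`; and `(n + 2) / (n + 1) ≤ 2`. -/
theorem kronF_bound (f : E.V 0) {n : ℕ} (u : E.VT 0 1 n) :
    ∃ s ≤ (√2 / E.evMin * ‖f‖) ^ 2 * ‖u‖ ^ 2,
      HasSum (fun j => (E.wtT 0 (-1) (n + 1) j : ℝ) * E.kronF f u j ^ 2) s := by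
  have hx : HasSum (fun r => ‖u r • (-f)‖ ^ 2) (‖E.embT n u‖ ^ 2 * ‖f‖ ^ 2) := by
    refine ((E.embT n u).hasSum_norm_sq.mul_right (‖f‖ ^ 2)).congr_fun fun r => ?_
    rw [norm_smul, norm_neg, mul_pow, Real.norm_eq_abs, sq_abs, wtT_zero, one_mul]
    rfl
  choose s' hs' hsum using fun l : Fin (n + 2) => E.slot_bound l _ E.norm_emb_sq_le hx
  obtain ⟨t, ht, h⟩ := E.kron_bound hsum
  refine ⟨t, ht.trans ?_, ?_⟩
  · refine (Finset.sum_le_sum fun l _ => hs' l).trans ?_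
    have hm := E.evMin_pos
    have hn : (0 : ℝ) < n + 1 := n.cast_add_one_pos
    have hn2 : ((n : ℝ) + 2) / (n + 1) ≤ 2 := by
      rw [div_le_iff₀ hn]
      linarith [n.cast_nonneg (α := ℝ)]
    rw [Finset.sum_const, Finset.card_univ, Fintype.card_fin, nsmul_eq_mul]
    calc ((n + 2 : ℕ) : ℝ) * (E.evMin⁻¹ * (‖E.embT n u‖ ^ 2 * ‖f‖ ^ 2))
        ≤ ((n + 2 : ℕ) : ℝ) *
            (E.evMin⁻¹ * (((n + 1) * E.evMin)⁻¹ * ‖u‖ ^ 2 * ‖f‖ ^ 2)) := by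
          gcongr
          exact E.norm_embT_sq_le u
      _ = ((n : ℝ) + 2) / (n + 1) * ((E.evMin⁻¹ * ‖f‖) ^ 2 * ‖u‖ ^ 2) := by
          push_cast
          field_simp
      _ ≤ 2 * ((E.evMin⁻¹ * ‖f‖) ^ 2 * ‖u‖ ^ 2) := by gcongr
      _ = _ := by
          rw [mul_pow (√2 / E.evMin), div_pow, Real.sq_sqrt zero_le_two]
          ring
  · convert h using 4 with j
    refine Finset.sum_congr rfl fun l _ => ?_
    exact mul_comm _ _

/-- Coercivity is inherited by the Kronecker sum: it is applied to every fiber in every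
variable, which costs one `λ` per variable. -/
theorem kronA_coercive (A : E.V 1 →L[ℝ] E.V (-1)) {γ lam : ℝ}
    (hA : ∀ v : E.V 1,
      WL.pair (A v) v + lam * ‖E.emb (zero_le_one : (0 : ℝ) ≤ 1) v‖ ^ 2 ≥ γ * ‖v‖ ^ 2)
    {n : ℕ} (u : E.VT 0 1 n) :
    γ * ‖u‖ ^ 2 ≤ ∑' j, E.kronA A u j * u j + (n + 1) * lam * ‖E.embT n u‖ ^ 2 := by
  obtain ⟨s, hs, hsu⟩ := E.exists_hasSum_slot u
  have hA2 : ∀ x, ‖A x‖ ^ 2 ≤ ‖A‖ ^ 2 * ‖x‖ ^ 2 := fun x => by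
    rw [← mul_pow]
    exact pow_le_pow_left₀ (norm_nonneg _) (A.le_opNorm x) 2
  have hl : ∀ l, ∃ p, γ * s l ≤ p + lam * ‖E.embT n u‖ ^ 2 ∧
      HasSum (fun j => A (E.slice u j l) (j l) * u j) p := fun l => by
    obtain ⟨s', -, hs'⟩ := E.slot_bound l A hA2 (E.hasSum_norm_fiber_sq (hs l))
    have hsum : Summable fun j : Fin (n + 1) → ℕ => A (E.slice u j l) (j l) * u j := by
      refine Summable.of_norm_bounded ((hs'.summable.add (hs l).summable).div_const 2) fun j => ?_
      rw [slice_eq_fiber]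
      exact WL.two_abs_mul_le (E.ev_pos (j l))
    refine ⟨_, ?_, hsum.hasSum⟩
    have h := hsum.hasSum
    rw [← (slotEquiv l).hasSum_iff] at h
    have h2 := h.prod_fiberwise (g := fun r => WL.pair (A (E.fiber u l r)) (E.fiber u l r))
      fun r => by
        refine (WL.summable_pair E.dual_wt (A (E.fiber u l r))
          (E.fiber u l r)).hasSum.congr_fun fun q => ?_
        rw [Function.comp_apply, slice_eq_fiber, removeNth_slotEquiv, slotEquiv_apply_self,
          fiber_apply]
    exact hasSum_le (fun r => hA (E.fiber u l r)) ((E.hasSum_norm_fiber_sq (hs l)).mul_left γ)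
      (h2.add ((E.hasSum_norm_emb_fiber_sq u l).mul_left lam))
  choose p hp hsum using hl
  have h : HasSum (fun j => E.kronA A u j * u j) (∑ l, p l) := by
    convert hasSum_sum fun l (_ : l ∈ Finset.univ) => hsum l using 2 with j
    rw [kronA, Finset.sum_mul]
  rw [h.tsum_eq, ← hsu, Finset.mul_sum]
  refine (Finset.sum_le_sum fun l _ => hp l).trans_eq ?_
  rw [Finset.sum_add_distrib, Finset.sum_const, Finset.card_univ, Fintype.card_fin, nsmul_eq_mul]
  push_cast
  ring


/-! ### The blocks as bounded operators -/

theorem exists_kronA_operator (A : E.V 1 →L[ℝ] E.V (-1)) {β : ℝ} (hβ : 0 ≤ β)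
    (hA : ∀ v, ‖A v‖ ≤ β * ‖v‖) (n : ℕ) :
    ∃ S : E.VT 0 1 n →ₗ[ℝ] E.VT 0 (-1) n,
      (∀ u j, S u j = E.kronA A u j) ∧ ∀ u, ‖S u‖ ≤ β * ‖u‖ := by
  refine WL.exists_operator
    { toFun := fun u => E.kronA A u
      map_add' := fun u u' => funext fun j => ?_
      map_smul' := fun c u => funext fun j => ?_ } hβ fun u => E.kronA_bound A hA u
  · refine (Finset.sum_congr rfl fun l _ => ?_).trans Finset.sum_add_distrib
    rw [show E.slice (u + u') j l = E.slice u j l + E.slice u' j l from rfl, map_add]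
    rfl
  · refine (Finset.sum_congr rfl fun l _ => ?_).trans (Finset.mul_sum _ _ _).symm
    rw [show E.slice (c • u) j l = c • E.slice u j l from rfl, map_smul]
    rfl

theorem exists_kronB_operator (B : E.VT 0 1 1 →L[ℝ] E.V (-1)) {b : ℝ} (hb : 0 ≤ b)
    (hB : ∀ v, ‖B v‖ ≤ b * ‖v‖) (n : ℕ) :
    ∃ S : E.VT 0 1 (n + 1) →ₗ[ℝ] E.VT 0 (-1) n,
      (∀ u j, S u j = E.kronB B u j) ∧ ∀ u, ‖S u‖ ≤ √2 * b * ‖u‖ := by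
  refine WL.exists_operator
    { toFun := fun u => E.kronB B u
      map_add' := fun u u' => funext fun j => ?_
      map_smul' := fun c u => funext fun j => ?_ } (by positivity) fun u => E.kronB_bound B hB u
  · refine (Finset.sum_congr rfl fun l _ => ?_).trans Finset.sum_add_distrib
    rw [show E.slice2 (u + u') j l = E.slice2 u j l + E.slice2 u' j l from rfl, map_add]
    rfl
  · refine (Finset.sum_congr rfl fun l _ => ?_).trans (Finset.mul_sum _ _ _).symm
    rw [show E.slice2 (c • u) j l = c • E.slice2 u j l from rfl, map_smul]
    rfl

theorem exists_kronF_operator (f : E.V 0) (n : ℕ) :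
    ∃ S : E.VT 0 1 n →ₗ[ℝ] E.VT 0 (-1) (n + 1),
      (∀ u j, S u j = E.kronF f u j) ∧ ∀ u, ‖S u‖ ≤ √2 / E.evMin * ‖f‖ * ‖u‖ := by
  have hm := E.evMin_pos
  refine WL.exists_operator
    { toFun := fun u => E.kronF f u
      map_add' := fun u u' => funext fun j => ?_
      map_smul' := fun c u => funext fun j => ?_ } (by positivity) fun u => E.kronF_bound f u
  · exact (Finset.sum_congr rfl fun l _ => mul_add _ _ _).trans Finset.sum_add_distrib
  · exact (Finset.sum_congr rfl fun l _ => mul_left_comm _ _ _).trans (Finset.mul_sum _ _ _).symm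

/-! ### Block operators -/

theorem extend_of_lt {N n : ℕ} (u : E.U 1 N) (h : n < N) : E.extend u n = u ⟨n, h⟩ := dif_pos h

theorem extend_fin {N : ℕ} (u : E.U 1 N) (n : Fin N) : E.extend u n = u n := dif_pos n.2

theorem extend_of_le {N n : ℕ} (u : E.U 1 N) (h : N ≤ n) : E.extend u n = 0 := dif_neg h.not_gt

theorem extend_add {N : ℕ} (u v : E.U 1 N) : E.extend (u + v) = E.extend u + E.extend v := by
  funext n
  by_cases h : n < N
  · simp [extend_of_lt, h]
  · simp [extend_of_le, not_lt.1 h]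

theorem extend_smul {N : ℕ} (c : ℝ) (u : E.U 1 N) : E.extend (c • u) = c • E.extend u := by
  funext n
  by_cases h : n < N
  · simp [extend_of_lt, h]
  · simp [extend_of_le, not_lt.1 h]

theorem sum_norm_extend_sq {N : ℕ} (u : E.U 1 N) :
    ∑ n ∈ Finset.range N, ‖E.extend u n‖ ^ 2 = ‖u‖ ^ 2 := by
  rw [PiLp.norm_sq_eq_of_L2, Finset.sum_range]
  exact Finset.sum_congr rfl fun n _ => by rw [extend_fin]

/-- A matrix of operators with the rows `K n` defines an operator on `N` moments. -/
theorem exists_blockOperator {N : ℕ}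
    (K : ∀ n : ℕ, (∀ m, E.VT 0 1 m) →ₗ[ℝ] E.VT 0 (-1) n) {C : ℝ} (hC : 0 ≤ C)
    (h : ∀ u : E.U 1 N, ∑ n ∈ Finset.range N, ‖K n (E.extend u)‖ ^ 2 ≤ C ^ 2 * ‖u‖ ^ 2) :
    ∃ D : E.U 1 N →L[ℝ] E.U (-1) N,
      (∀ u n, D u n = K n (E.extend u)) ∧ ∀ u, ‖D u‖ ≤ C * ‖u‖ := by
  let D : E.U 1 N →ₗ[ℝ] E.U (-1) N :=
    { toFun := fun u => WithLp.toLp 2 fun n : Fin N => K n (E.extend u)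
      map_add' := fun u v => by
        ext1 n
        exact (congrArg (K n) (E.extend_add u v)).trans (map_add _ _ _)
      map_smul' := fun c u => by
        ext1 n
        exact (congrArg (K n) (E.extend_smul c u)).trans (map_smul _ _ _) }
  have hD : ∀ u, ‖D u‖ ≤ C * ‖u‖ := fun u => by
    refine (sq_le_sq₀ (norm_nonneg _) (mul_nonneg hC (norm_nonneg _))).1 ?_
    rw [mul_pow, PiLp.norm_sq_eq_of_L2]
    refine le_trans (le_of_eq ?_) (h u)
    rw [Finset.sum_range]
    rfl
  exact ⟨D.mkContinuous C hD, fun _ _ => rfl, hD⟩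

theorem exists_blockDiagonal (N : ℕ) {C : ℝ} (hC : 0 ≤ C)
    (S : ∀ n, E.VT 0 1 n →ₗ[ℝ] E.VT 0 (-1) n) (hS : ∀ n u, ‖S n u‖ ≤ C * ‖u‖) :
    ∃ D : E.U 1 N →L[ℝ] E.U (-1) N,
      (∀ u (n : Fin N), D u n = S n (E.extend u n)) ∧ ∀ u, ‖D u‖ ≤ C * ‖u‖ := by
  refine E.exists_blockOperator (fun n => (S n).comp (LinearMap.proj n)) hC fun u => ?_
  rw [← sum_norm_extend_sq, Finset.mul_sum]
  refine Finset.sum_le_sum fun n _ => ?_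
  rw [← mul_pow]
  exact pow_le_pow_left₀ (norm_nonneg _) (hS n _) 2

theorem exists_blockUpper (N : ℕ) {C : ℝ} (hC : 0 ≤ C)
    (S : ∀ n, E.VT 0 1 (n + 1) →ₗ[ℝ] E.VT 0 (-1) n) (hS : ∀ n u, ‖S n u‖ ≤ C * ‖u‖) :
    ∃ D : E.U 1 N →L[ℝ] E.U (-1) N,
      (∀ u (n : Fin N), D u n = S n (E.extend u (n + 1))) ∧ ∀ u, ‖D u‖ ≤ C * ‖u‖ := by
  refine E.exists_blockOperator (fun n => (S n).comp (LinearMap.proj (n + 1))) hC fun u => ?_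
  calc ∑ n ∈ Finset.range N, ‖S n (E.extend u (n + 1))‖ ^ 2
      ≤ ∑ n ∈ Finset.range N, C ^ 2 * ‖E.extend u (n + 1)‖ ^ 2 :=
        Finset.sum_le_sum fun n _ => by
          rw [← mul_pow]
          exact pow_le_pow_left₀ (norm_nonneg _) (hS n _) 2
    _ = C ^ 2 * ∑ n ∈ Finset.range N, ‖E.extend u (n + 1)‖ ^ 2 := by rw [Finset.mul_sum]
    _ ≤ C ^ 2 * ‖u‖ ^ 2 := by
        refine mul_le_mul_of_nonneg_left ?_ (sq_nonneg C)
        have h := Finset.sum_range_succ' (fun n => ‖E.extend u n‖ ^ 2) N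
        rw [Finset.sum_range_succ, E.extend_of_le u le_rfl, sum_norm_extend_sq] at h
        simp only [norm_zero] at h
        nlinarith [sq_nonneg ‖E.extend u 0‖]

theorem exists_blockLower (N : ℕ) {C : ℝ} (hC : 0 ≤ C)
    (S : ∀ n, E.VT 0 1 n →ₗ[ℝ] E.VT 0 (-1) (n + 1)) (hS : ∀ n u, ‖S n u‖ ≤ C * ‖u‖) :
    ∃ D : E.U 1 N →L[ℝ] E.U (-1) N,
      (∀ u (h : 0 < N), D u ⟨0, h⟩ = 0) ∧
      (∀ u n (h : n + 1 < N), D u ⟨n + 1, h⟩ = S n (E.extend u n)) ∧ ∀ u, ‖D u‖ ≤ C * ‖u‖ := by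
  let K : ∀ n : ℕ, (∀ m, E.VT 0 1 m) →ₗ[ℝ] E.VT 0 (-1) n
    | 0 => 0
    | n + 1 => (S n).comp (LinearMap.proj n)
  obtain ⟨D, hD, hn⟩ := E.exists_blockOperator (N := N) K hC fun u => by
    rcases N with - | N
    · simp only [Finset.range_zero, Finset.sum_empty]
      positivity
    rw [Finset.sum_range_succ', ← sum_norm_extend_sq, Finset.mul_sum, Finset.sum_range_succ]
    refine add_le_add (Finset.sum_le_sum fun n _ => ?_) ?_
    · rw [← mul_pow]
      exact pow_le_pow_left₀ (norm_nonneg _) (hS n _) 2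
    · change ‖(0 : E.VT 0 (-1) 0)‖ ^ 2 ≤ _
      rw [norm_zero, zero_pow two_ne_zero]
      positivity
  exact ⟨D, fun u h => hD u ⟨0, h⟩, fun u n h => hD u ⟨n + 1, h⟩, hn⟩

theorem pairU_add_left {N : ℕ} (g g' : E.U (-1) N) (v : E.U 1 N) :
    E.pairU (g + g') v = E.pairU g v + E.pairU g' v := by
  rw [pairU, pairU, pairU, ← Finset.sum_add_distrib]
  exact Finset.sum_congr rfl fun n _ => WL.pair_add_left (E.dual_wtT n) _ _ _

theorem abs_pairU_le {N : ℕ} (g : E.U (-1) N) (v : E.U 1 N) : |E.pairU g v| ≤ ‖g‖ * ‖v‖ := by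
  refine (Finset.abs_sum_le_sum_abs _ _).trans ?_
  refine (Finset.sum_le_sum fun (n : Fin N) _ => WL.abs_pair_le (E.dual_wtT n) (g n) (v n)).trans ?_
  refine abs_le_of_sq_le_sq' ?_ (by positivity) |>.2
  rw [mul_pow, PiLp.norm_sq_eq_of_L2, PiLp.norm_sq_eq_of_L2]
  exact Finset.sum_mul_sq_le_sq_mul_sq _ _ _

/-! ### The Carleman block operator -/

theorem exists_ne_zero_V_one : ∃ v : E.V 1, v ≠ 0 := by
  have hs : Summable fun i => (E.wt 1 i : ℝ) * (Pi.single 0 1 : ℕ → ℝ) i ^ 2 :=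
    summable_of_ne_finset_zero (s := {0}) fun i hi => by
      rw [Pi.single_eq_of_ne (by simpa using hi)]
      simp
  refine ⟨⟨Pi.single 0 1, hs⟩, fun h => ?_⟩
  have h0 : (Pi.single 0 1 : ℕ → ℝ) 0 = 0 := congrArg (fun x : E.V 1 => x 0) h
  simp at h0

/-- A bounded form on `V` is a bounded operator `V → V'` with the same bound. -/
theorem norm_le_of_abs_pair_le {A : E.V 1 →L[ℝ] E.V (-1)} {β : ℝ}
    (hA : ∀ v w : E.V 1, |WL.pair (A v) w| ≤ β * ‖v‖ * ‖w‖) (v : E.V 1) : ‖A v‖ ≤ β * ‖v‖ := by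
  obtain ⟨w, hw, h⟩ := WL.exists_pair_eq_norm_sq E.dual_wt (A v)
  have h1 := hA v w
  rw [h, hw, abs_of_nonneg (sq_nonneg _)] at h1
  rcases eq_or_ne (A v) 0 with h0 | h0
  · have h2 := hA v v
    rw [h0, WL.pair] at h2
    simp only [WL.zero_apply, zero_mul, tsum_zero, abs_zero] at h2
    rw [h0, norm_zero]
    by_contra! hlt
    have hv : 0 < ‖v‖ := norm_pos_iff.2 fun h => by simp [h] at hlt
    exact (mul_neg_of_neg_of_pos hlt hv).not_ge h2
  · exact le_of_mul_le_mul_right (by linarith) (norm_pos_iff.2 h0)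

/-- The block tridiagonal operator for arbitrary bounded `A`, `B` and `f`. -/
theorem exists_tridiagonal (A : E.V 1 →L[ℝ] E.V (-1)) {β γ lam b : ℝ} (hlam : 0 ≤ lam)
    (hA_bounded : ∀ v w : E.V 1, |WL.pair (A v) w| ≤ β * ‖v‖ * ‖w‖)
    (hA_coercive : ∀ v : E.V 1,
      WL.pair (A v) v + lam * ‖E.emb (zero_le_one : (0 : ℝ) ≤ 1) v‖ ^ 2 ≥ γ * ‖v‖ ^ 2)
    (B : E.VT 0 1 1 →L[ℝ] E.V (-1)) (hb : 0 ≤ b) (hB : ∀ v, ‖B v‖ ≤ b * ‖v‖) (f : E.V 0) (N : ℕ) :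
    ∃ At : E.U 1 N →L[ℝ] E.U (-1) N,
      (∀ u (n : Fin N) j, At u n j = E.row A B f (E.extend u) n j) ∧
      (∀ u v, |E.pairU (At u) v| ≤ (β + (√2 * b + √2 / E.evMin * ‖f‖)) * ‖u‖ * ‖v‖) ∧
      ∀ v, E.pairU (At v) v + N * lam * E.normSqY v ≥
        (γ - (√2 * b + √2 / E.evMin * ‖f‖)) * ‖v‖ ^ 2 := by
  have hA := E.norm_le_of_abs_pair_le hA_bounded
  -- `V ≠ 0`, so that a negative `β` is impossible
  have hβ : 0 ≤ β := by
    obtain ⟨v, hv⟩ := E.exists_ne_zero_V_one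
    exact nonneg_of_mul_nonneg_left ((norm_nonneg _).trans (hA v)) (norm_pos_iff.2 hv)
  have hm := E.evMin_pos
  choose SA hSA hSAn using E.exists_kronA_operator A hβ hA
  choose SB hSB hSBn using E.exists_kronB_operator B hb hB
  choose SF hSF hSFn using E.exists_kronF_operator f
  obtain ⟨DA, hDA, hDAn⟩ := E.exists_blockDiagonal N hβ SA hSAn
  obtain ⟨DB, hDB, hDBn⟩ := E.exists_blockUpper N (by positivity) SB hSBn
  obtain ⟨DF, hDF0, hDF, hDFn⟩ := E.exists_blockLower N (by positivity) SF hSFn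
  have hsplit : ∀ u v, E.pairU ((DF + DA + DB) u) v =
      E.pairU (DF u) v + E.pairU (DA u) v + E.pairU (DB u) v := fun u v => by
    rw [← pairU_add_left, ← pairU_add_left]
    rfl
  have bound : ∀ {D : E.U 1 N →L[ℝ] E.U (-1) N} {C : ℝ}, (∀ u, ‖D u‖ ≤ C * ‖u‖) →
      ∀ u v, |E.pairU (D u) v| ≤ C * ‖u‖ * ‖v‖ := fun h u v =>
    (E.abs_pairU_le _ _).trans (mul_le_mul_of_nonneg_right (h u) (norm_nonneg v))
  refine ⟨DF + DA + DB, fun u n j => ?_, fun u v => ?_, fun v => ?_⟩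
  · change DF u n j + DA u n j + DB u n j = _
    rw [hDA, hDB, hSA, hSB]
    obtain ⟨_ | n, hn⟩ := n
    · rw [hDF0, WL.zero_apply, zero_add]
      rfl
    · rw [hDF, hSF]
      rfl
  · rw [hsplit]
    refine (abs_add_three _ _ _).trans ?_
    linarith [bound hDAn u v, bound hDBn u v, bound hDFn u v]
  · have hdiag : γ * ‖v‖ ^ 2 ≤ E.pairU (DA v) v + N * lam * E.normSqY v := by
      rw [PiLp.norm_sq_eq_of_L2, pairU, normSqY, Finset.mul_sum, Finset.mul_sum,
        ← Finset.sum_add_distrib]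
      refine Finset.sum_le_sum fun n _ => ?_
      have hn : (((n : ℕ) : ℝ) + 1) * lam ≤ N * lam :=
        mul_le_mul_of_nonneg_right (by exact_mod_cast n.2) hlam
      have hp : WL.pair (DA v n) (v n) = ∑' j, E.kronA A (v n) j * v n j :=
        tsum_congr fun j => by rw [hDA, hSA, extend_fin]
      rw [hp]
      exact (E.kronA_coercive A hA_coercive (v n)).trans
        (add_le_add_right (mul_le_mul_of_nonneg_right hn (sq_nonneg _)) _)
    rw [hsplit]
    have hB' := (abs_le.1 (bound hDBn v v)).1
    have hF' := (abs_le.1 (bound hDFn v v)).1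
    linarith

/-! ### The transformed operators -/

theorem norm_liftB_le (A : E.V 1 →L[ℝ] E.V (-1)) (lam α : ℝ)
    {B : E.VT α 1 1 →L[ℝ] E.V (α - 1)} {cB : ℝ} (hcB : 0 < cB)
    (hB : ∀ v : E.VT α 1 1, ‖B v‖ ≤ cB * ‖v‖) :
    ENNReal.ofReal (√2 * ‖E.liftB A lam α B‖) ≤ E.cUpper A lam α cB := by
  rw [ENNReal.ofReal_mul (Real.sqrt_nonneg _), cUpper, mul_assoc]
  gcongr
  rw [ofReal_norm, cLam]
  have h1 : ‖B‖ₑ ≤ ENNReal.ofReal cB := by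
    rw [← ofReal_norm]
    exact ENNReal.ofReal_le_ofReal (B.opNorm_le_bound hcB.le hB)
  calc ‖E.liftB A lam α B‖ₑ
      ≤ ‖opOf fun S : E.V (α - 1) →L[ℝ] E.V (-1) => E.IsPow A lam (α / 2) S‖ₑ *
          (‖B‖ₑ * ‖opOf fun P : E.VT 0 1 1 →L[ℝ] E.VT α 1 1 => E.IsTensorPow A lam (α / 2) P‖ₑ) :=
        (ContinuousLinearMap.opENorm_comp_le _ _).trans
          (mul_le_mul_right (ContinuousLinearMap.opENorm_comp_le _ _) _)
    _ ≤ normOf (fun S : E.V (α - 1) →L[ℝ] E.V (-1) => E.IsPow A lam (α / 2) S) *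
          (ENNReal.ofReal cB *
            normOf fun P : E.VT 0 1 1 →L[ℝ] E.VT α 1 1 => E.IsTensorPow A lam (α / 2) P) :=
        mul_le_mul' (enorm_opOf_le _) (mul_le_mul' h1 (enorm_opOf_le _))
    _ = _ := by ring

/-- The constant of the block tridiagonal operator is at most `c_P`, almost everywhere in time. -/
theorem offDiagonal_le_cP (A : E.V 1 →L[ℝ] E.V (-1)) (lam α : ℝ)
    {B : E.VT α 1 1 →L[ℝ] E.V (α - 1)} {cB : ℝ} (hcB : 0 < cB)
    (hB : ∀ v : E.VT α 1 1, ‖B v‖ ≤ cB * ‖v‖) (T : EReal) (f : ℝ → E.V α) :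
    ∀ᵐ t ∂(timeMeasure T),
      ENNReal.ofReal (√2 * ‖E.liftB A lam α B‖ + √2 / E.evMin * ‖E.liftF A lam α (f t)‖) ≤
        E.cP A lam α cB T f := by
  have hm := E.evMin_pos
  filter_upwards [ae_le_eLpNormEssSup (f := f) (μ := timeMeasure T)] with t ht
  rw [ENNReal.ofReal_add (by positivity) (by positivity)]
  refine add_le_add (E.norm_liftB_le A lam α hcB hB) ?_
  rw [ENNReal.ofReal_mul (by positivity), cLower, mul_assoc, ofReal_norm, eLpNorm_exponent_top]
  gcongr
  refine (ContinuousLinearMap.le_opENorm _ _).trans ?_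
  exact mul_le_mul' (enorm_opOf_le _) ht

end EigenSystem
end Carleman

theorem mainTheorem6 (E : EigenSystem)
    -- the linear part, bounded and coercive
    (A : E.V 1 →L[ℝ] E.V (-1)) (β γ lam : ℝ) (hγ : 0 < γ) (hlam : 0 ≤ lam)
    (hA_bounded : ∀ v w : E.V 1, |WL.pair (A v) w| ≤ β * ‖v‖ * ‖w‖)
    (hA_coercive : ∀ v : E.V 1,
      WL.pair (A v) v + lam * ‖E.emb (zero_le_one : (0 : ℝ) ≤ 1) v‖ ^ 2 ≥ γ * ‖v‖ ^ 2)
    -- compatibility of the domains of the fractional powers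
    (αbar α : ℝ) (hαbar : 1 ≤ αbar) (hdom : E.domL (αbar / 2) = E.domPow A lam (αbar / 2))
    (hα : 0 ≤ α) (hα' : α ≤ αbar - 1)
    -- the quadratic part
    (B : E.VT α 1 1 →L[ℝ] E.V (α - 1)) (cB : ℝ) (hcB : 0 < cB)
    (hB : ∀ v : E.VT α 1 1, ‖B v‖ ≤ cB * ‖v‖)
    -- the forcing on the time interval `(0, T)`
    (T : EReal) (f : ℝ → E.V α)
    (hf : MemLp f ⊤ (timeMeasure T))
    -- smallness
    (hsmall : E.cP A lam α cB T f < ENNReal.ofReal γ) :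
    ∀ᵐ t ∂(timeMeasure T), ∀ N : ℕ,
      ∃ At : E.U 1 N →L[ℝ] E.U (-1) N, E.IsCarleman A lam α B (f t) At ∧
        (∀ u v : E.U 1 N, |E.pairU (At u) v| ≤
          (β + (E.cP A lam α cB T f).toReal) * ‖u‖ * ‖v‖) ∧
        (∀ v : E.U 1 N, E.pairU (At v) v + N * lam * E.normSqY v ≥
          (γ - (E.cP A lam α cB T f).toReal) * ‖v‖ ^ 2) := by
  filter_upwards [E.offDiagonal_le_cP A lam α hcB hB T f] with t ht N
  have hc := (ENNReal.ofReal_le_iff_le_toReal hsmall.ne_top).1 ht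
  obtain ⟨At, hrow, hbound, hcoer⟩ := E.exists_tridiagonal A hlam hA_bounded hA_coercive
    (E.liftB A lam α B) (norm_nonneg _) (E.liftB A lam α B).le_opNorm (E.liftF A lam α (f t)) N
  refine ⟨At, hrow, fun u v => (hbound u v).trans ?_, fun v => le_trans ?_ (hcoer v)⟩
  · gcongr
  · gcongr
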